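/- Let $\mathcal{A}$ be a unital $C^*$-algebra and let $H_{\mathcal{A}}$ be the standard right Hilbert $\mathcal{A}$-module of all sequences $x=(x_k)_{k\in\mathbb{N}}$ in $\mathcal{A}$ for which $\sum_k x_k^*x_k$ converges in norm, with inner product $\langle x,y\rangle=\sum_k x_k^*y_k$ and norm $\|x\|=\|\langle x,x\rangle\|^{1/2}$. Let $B(H_{\mathcal{A}})$ be the ring of bounded $\mathcal{A}$-linear operators on $H_{\mathcal{A}}$ and $B^a(H_{\mathcal{A}})$ the set of adjointable ones. For $\alpha\in\mathcal{A}$ let $\alpha I$ be the operator $(x_k)_k\mapsto(\alpha x_k)_k$. Let $K(\mathcal{A})$ be the $K_0$-group of $\mathcal{A}$, that is, the Grothendieck group of the finitely generated Hilbert $\mathcal{A}$-modules: it is generated by the classes $[M]$ of the finitely generated closed submodules $M$ of $H_{\mathcal{A}}$, with the relations $[M]=[N]+[P]$ whenever $M\cong N\oplus P$. Assume that $K(\mathcal{A})$ satisfies the cancellation property: if $M,N$ are finitely generated closed submodules of $H_{\mathcal{A}}$ with $[M]=[N]$ in $K(\mathcal{A})$, then $M\cong N$. An operator $G\in B^a(H_{\mathcal{A}})$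 is called $\mathcal{A}$-Fredholm if there are closed submodules with $H_{\mathcal{A}}=M_1\,\tilde\oplus\,N_1=M_2\,\tilde\oplus\,N_2$ (direct sums, not necessarily orthogonal), $N_1,N_2$ finitely generated, such that $G$ maps $M_1$ isomorphically onto $M_2$ and maps $N_1$ into $N_2$; its index is then $[N_1]-[N_2]\in K(\mathcal{A})$, which does not depend on the decomposition. Let $\mathcal{M}\Phi_0(H_{\mathcal{A}})$ be the set of $\mathcal{A}$-Fredholm operators of index $0$. Let $F\in B^a(H_{\mathcal{A}})$ and put $$\sigma^{\mathcal{A}}(F)=\{\alpha\in\mathcal{A}: F-\alpha I \text{ is not invertible in } B(H_{\mathcal{A}})\},\qquad \sigma_{ew}^{\mathcal{A}}(F)=\{\alpha\in\mathcal{A}: F-\alpha I\notin\mathcal{M}\Phi_0(H_{\mathcal{A}})\},$$ $$\sigma_p^{\mathcal{A}}(F)=\{\alpha\in\mathcal{A}: F-\alpha I \text{ is not injective}\},\qquad \sigma_{cl}^{\mathcal{A}}(F)=\{\alpha\in\mathcal{A}: \text{the range of } F-\alpha I \text{ is not closed}\}.$$ Then $$\sigma^{\mathcal{A}}(F)=\sigma_{ew}^{\mathcal{A}}(F)\cup\sigma_p^{\mathcal{A}}(F)\cup\sigma_{cl}^{\mathcal{A}}(F).$$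 -/

import Mathlib

open scoped MulOpposite

noncomputable section

namespace HilbertCStar

section Convergence

variable {A : Type*} [CStarAlgebra A]

lemma summable_of_le [PartialOrder A] [StarOrderedRing A] {f g : ℕ → A}
    (h0 : ∀ k, 0 ≤ f k) (hfg : ∀ k, f k ≤ g k) (hg : Summable g) : Summable f := by
  rw [summable_iff_vanishing_norm] at hg ⊢
  intro ε hε
  obtain ⟨s, hs⟩ := hg ε hε
  refine ⟨s, fun t ht => lt_of_le_of_lt ?_ (hs t ht)⟩
  exact CStarAlgebra.norm_le_norm_of_nonneg_of_le (Finset.sum_nonneg fun k _ => h0 k)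
    (Finset.sum_le_sum fun k _ => hfg k)

lemma summable_add_sq {x y : ℕ → A} (hx : Summable fun k => star (x k) * x k)
    (hy : Summable fun k => star (y k) * y k) :
    Summable fun k => star (x k + y k) * (x k + y k) := by
  let _ := CStarAlgebra.spectralOrder A
  have := CStarAlgebra.spectralOrderedRing A
  refine summable_of_le (g := fun k => (star (x k) * x k + star (y k) * y k) +
    (star (x k) * x k + star (y k) * y k)) (fun k => star_mul_self_nonneg _) (fun k => ?_)
    ((hx.add hy).add (hx.add hy))
  have h := star_mul_self_nonneg (x k - y k)
  rw [← sub_nonneg]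
  convert h using 1
  simp only [star_add, star_sub]
  noncomm_ring

lemma summable_mul_right_sq {x : ℕ → A} (hx : Summable fun k => star (x k) * x k) (a : A) :
    Summable fun k => star (x k * a) * (x k * a) := by
  have h := (hx.mul_left (star a)).mul_right a
  refine h.congr fun k => ?_
  simp only [star_mul, mul_assoc]

end Convergence

variable (A : Type*) [CStarAlgebra A]

/-- The sequences `x` in `A` for which `∑ₖ xₖ* xₖ` converges in norm (for positive terms in a
C*-algebra, convergence of the partial sums and unconditional convergence are the same), as a
submodule of the right `A`-module of all sequences. Right `A`-modules are modules over `Aᵐᵒᵖ`. -/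
def squareSummable : Submodule Aᵐᵒᵖ (ℕ → A) where
  carrier := {x | Summable fun k => star (x k) * x k}
  add_mem' hx hy := summable_add_sq hx hy
  zero_mem' := by simp
  smul_mem' a _ hx := summable_mul_right_sq hx a.unop

/-- The standard right Hilbert `A`-module `H_A`. -/
def StdModule : Type _ := squareSummable A

namespace StdModule

instance : AddCommGroup (StdModule A) := inferInstanceAs (AddCommGroup (squareSummable A))
instance : Module Aᵐᵒᵖ (StdModule A) := inferInstanceAs (Module Aᵐᵒᵖ (squareSummable A))
instance : Module ℂ (StdModule A) := inferInstanceAs (Module ℂ (squareSummable A))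

variable {A}

instance : CoeFun (StdModule A) (fun _ => ℕ → A) := ⟨Subtype.val⟩

@[ext] lemma ext {x y : StdModule A} (h : ∀ k, x k = y k) : x = y := Subtype.ext (funext h)

@[simp] lemma add_apply (x y : StdModule A) (k : ℕ) : (x + y) k = x k + y k := rfl
@[simp] lemma zero_apply (k : ℕ) : (0 : StdModule A) k = 0 := rfl
@[simp] lemma op_smul_apply (a : Aᵐᵒᵖ) (x : StdModule A) (k : ℕ) : (a • x) k = x k * a.unop := rfl
@[simp] lemma smul_apply (c : ℂ) (x : StdModule A) (k : ℕ) : (c • x) k = c • x k := rfl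

lemma summable_sq (x : StdModule A) : Summable fun k => star (x k) * x k := x.2

lemma summable_inner (x y : StdModule A) : Summable fun k => star (x k) * y k := by
  have h1 := (summable_sq (x + y)).sub ((summable_sq x).add (summable_sq y))
  have h2 := (summable_sq (x + Complex.I • y)).sub ((summable_sq x).add (summable_sq y))
  have h3 := (h1.sub (h2.const_smul Complex.I)).const_smul (1 / 2 : ℂ)
  refine h3.congr fun k => ?_
  simp only [add_apply, smul_apply, star_add, star_smul, mul_add, add_mul, smul_mul_assoc,
    mul_smul_comm, RCLike.star_def, Complex.conj_I, smul_sub, smul_add, smul_smul]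
  have hI : Complex.I * Complex.I = -1 := Complex.I_mul_I
  match_scalars <;> (ring_nf; try simp [Complex.I_sq]) <;> norm_num

/-- The `A`-valued inner product `⟨x, y⟩ = ∑ₖ xₖ* yₖ` on `H_A`. -/
def inn (x y : StdModule A) : A := ∑' k, star (x k) * y k

/-- The norm `‖x‖ = ‖⟨x, x⟩‖^{1/2}` on `H_A`. -/
instance : Norm (StdModule A) := ⟨fun x => √‖inn x x‖⟩

lemma norm_def (x : StdModule A) : ‖x‖ = √‖inn x x‖ := rfl

lemma normedSpaceCore : NormedSpace.Core ℂ (StdModule A) := by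
  let _ := CStarAlgebra.spectralOrder Aᵐᵒᵖ
  have := CStarAlgebra.spectralOrderedRing Aᵐᵒᵖ
  have hop (x y : StdModule A) : MulOpposite.op (inn x y) =
      ∑' k, MulOpposite.op (y k) * star (MulOpposite.op (x k)) := by
    have h := ((summable_inner x y).hasSum.map
      (MulOpposite.opAddEquiv (α := A)) MulOpposite.continuous_op).tsum_eq
    simp only [inn]
    rw [MulOpposite.opAddEquiv_apply] at h
    rw [← h]
    rfl
  let _ : CStarModule Aᵐᵒᵖ (StdModule A) :=
    { inner := fun x y => MulOpposite.op (inn x y)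
      inner_add_right := by
        intro x y z
        rw [← MulOpposite.op_add]
        congr 1
        simp only [inn, add_apply, mul_add]
        exact (summable_inner x y).tsum_add (summable_inner x z)
      inner_self_nonneg := by
        intro x
        change 0 ≤ MulOpposite.op (inn x x)
        rw [hop]
        exact tsum_nonneg fun k => mul_star_self_nonneg _
      inner_self := by
        intro x
        change MulOpposite.op (inn x x) = 0 ↔ x = 0
        constructor
        · intro h
          rw [hop] at h
          have hs : Summable fun k => MulOpposite.op (x k) * star (MulOpposite.op (x k)) :=
            ((summable_inner x x).hasSum.map
              (MulOpposite.opAddEquiv (α := A)) MulOpposite.continuous_op).summable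
          ext k
          have hk : MulOpposite.op (x k) * star (MulOpposite.op (x k)) ≤ 0 := by
            rw [← h]
            exact hs.le_tsum k fun j _ => mul_star_self_nonneg _
          have := le_antisymm hk (mul_star_self_nonneg _)
          rw [CStarRing.mul_star_self_eq_zero_iff] at this
          simpa using this
        · rintro rfl
          simp [inn]
      inner_op_smul_right := by
        intro a x y
        apply MulOpposite.unop_injective
        simp only [inn, op_smul_apply, ← mul_assoc, MulOpposite.unop_mul, MulOpposite.unop_op]
        exact (summable_inner x y).tsum_mul_right _
      inner_smul_right_complex := by
        intro c x y
        apply MulOpposite.unop_injective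
        simp only [inn, smul_apply, mul_smul_comm, MulOpposite.unop_smul, MulOpposite.unop_op]
        exact (summable_inner x y).tsum_const_smul c
      star_inner := by
        intro x y
        apply MulOpposite.unop_injective
        simp only [inn, MulOpposite.unop_star, MulOpposite.unop_op]
        rw [tsum_star]
        simp
      norm_eq_sqrt_norm_inner_self := fun x => rfl }
  exact CStarModule.normedSpaceCore Aᵐᵒᵖ

instance : NormedAddCommGroup (StdModule A) := NormedAddCommGroup.ofCore normedSpaceCore
instance : NormedSpace ℂ (StdModule A) := NormedSpace.ofCore normedSpaceCore

lemma summable_left_mul (a : A) (x : StdModule A) :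
    (Summable fun k => star (a * x k) * (a * x k)) ∧
      ‖∑' k, star (a * x k) * (a * x k)‖ ≤ ‖a‖ ^ 2 * ‖inn x x‖ := by
  let _ := CStarAlgebra.spectralOrder A
  have := CStarAlgebra.spectralOrderedRing A
  have hle (k : ℕ) : star (a * x k) * (a * x k) ≤ (‖a‖ ^ 2) • (star (x k) * x k) := by
    have h := CStarAlgebra.star_left_conjugate_le_norm_smul (a := x k) (b := star a * a)
      (IsSelfAdjoint.star_mul_self a)
    rw [CStarRing.norm_star_mul_self, ← sq] at h
    simpa [star_mul, mul_assoc] using h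
  have hs := (summable_sq x).const_smul (‖a‖ ^ 2)
  have hs' := summable_of_le (fun k => star_mul_self_nonneg (a * x k)) hle hs
  refine ⟨hs', ?_⟩
  calc ‖∑' k, star (a * x k) * (a * x k)‖
      ≤ ‖∑' k, (‖a‖ ^ 2) • (star (x k) * x k)‖ :=
        CStarAlgebra.norm_le_norm_of_nonneg_of_le
          (tsum_nonneg fun k => star_mul_self_nonneg _) (hs'.tsum_le_tsum hle hs)
    _ = ‖a‖ ^ 2 * ‖inn x x‖ := by
        rw [(summable_sq x).tsum_const_smul, norm_smul]
        simp [inn]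

/-- Coordinatewise left multiplication by `α` on `H_A`, as an algebraic `A`-linear map. -/
def leftMul (a : A) : StdModule A →ₗ[Aᵐᵒᵖ] StdModule A where
  toFun x := ⟨fun k => a * x k, (summable_left_mul a x).1⟩
  map_add' x y := by ext k; exact mul_add a (x k) (y k)
  map_smul' b x := by ext k; exact (mul_assoc a (x k) b.unop).symm

lemma norm_leftMul_le (a : A) (x : StdModule A) : ‖leftMul a x‖ ≤ ‖a‖ * ‖x‖ := by
  rw [norm_def, norm_def]
  calc _ ≤ √(‖a‖ ^ 2 * ‖inn x x‖) := Real.sqrt_le_sqrt (summable_left_mul a x).2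
    _ = ‖a‖ * √‖inn x x‖ := by
      rw [Real.sqrt_mul (by positivity), Real.sqrt_sq (norm_nonneg a)]

/-- The operator `αI : (x₀, x₁, …) ↦ (αx₀, αx₁, …)` on `H_A`, as a bounded `A`-linear operator. -/
def scalarOp (a : A) : StdModule A →L[Aᵐᵒᵖ] StdModule A where
  toLinearMap := leftMul a
  cont := AddMonoidHomClass.continuous_of_bound (leftMul a) ‖a‖ (norm_leftMul_le a)

@[simp] lemma scalarOp_apply (a : A) (x : StdModule A) (k : ℕ) : scalarOp a x k = a * x k := rfl

end StdModule

open StdModule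

/-! Throughout, `B(H_A)` is the ring `StdModule A →L[Aᵐᵒᵖ] StdModule A` of bounded right
`A`-linear operators. -/

/-- The closed, (algebraically) finitely generated submodules of `H_A`. -/
def FGSubmodule : Type _ :=
  {M : Submodule Aᵐᵒᵖ (StdModule A) // IsClosed (M : Set (StdModule A)) ∧ M.FG}

/-- The relations `[M] = [N] + [P]`, one for every isomorphism `M ≅ N ⊕ P`. -/
def kRelations : Set (FreeAbelianGroup (FGSubmodule A)) :=
  {r | ∃ M N P : FGSubmodule A, Nonempty (M.1 ≃L[Aᵐᵒᵖ] (N.1 × P.1)) ∧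
    r = FreeAbelianGroup.of M - (FreeAbelianGroup.of N + FreeAbelianGroup.of P)}

/-- The group `K(A) = K₀(A)`: the Grothendieck group of the finitely generated Hilbert `A`-modules
with respect to direct sums. It is presented by one generator `[M]` for each finitely generated
closed submodule `M` of `H_A` (every finitely generated Hilbert `A`-module, that is, every finitely
generated projective `A`-module, is isomorphic to one of these) and the relations
`[M] = [N] + [P]` whenever `M ≅ N ⊕ P`; in particular `[M]` depends only on the isomorphism
class of `M`. -/
abbrev KGroup : Type _ :=
  FreeAbelianGroup (FGSubmodule A) ⧸ AddSubgroup.closure (kRelations A)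

variable {A}

/-- The class `[M]` in `K(A)`. -/
def kClass (M : FGSubmodule A) : KGroup A :=
  QuotientAddGroup.mk (FreeAbelianGroup.of M)

variable (A) in
/-- The cancellation property of `K(A)`: any two finitely generated closed submodules of `H_A`
with the same class in `K(A)` are isomorphic. -/
def HasCancellation : Prop :=
  ∀ M N : FGSubmodule A, kClass M = kClass N → Nonempty (M.1 ≃L[Aᵐᵒᵖ] N.1)

/-- `F ∈ B(H_A)` belongs to `B^a(H_A)`. -/
def IsAdjointable (F : StdModule A →L[Aᵐᵒᵖ] StdModule A) : Prop :=
  ∃ G : StdModule A →L[Aᵐᵒᵖ] StdModule A, ∀ x y, inn (F x) y = inn x (G y)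

/-- `H_A = M₁ ⊕̃ N₁ → M₂ ⊕̃ N₂ = H_A` is a Fredholm decomposition for `F`: all four submodules are
closed, `N₁` and `N₂` are finitely generated, and `F` is diagonal with respect to the two (not
necessarily orthogonal) direct sums, its restriction `M₁ → M₂` being an isomorphism. -/
structure IsFredholmDecomposition (F : StdModule A →L[Aᵐᵒᵖ] StdModule A)
    (M₁ M₂ : Submodule Aᵐᵒᵖ (StdModule A)) (N₁ N₂ : FGSubmodule A) : Prop where
  isClosed_dom : IsClosed (M₁ : Set (StdModule A))
  isClosed_cod : IsClosed (M₂ : Set (StdModule A))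
  isCompl_dom : IsCompl M₁ N₁.1
  isCompl_cod : IsCompl M₂ N₂.1
  exists_equiv : ∃ e : M₁ ≃L[Aᵐᵒᵖ] M₂, ∀ x : M₁, (e x : StdModule A) = F x
  map_mem : ∀ x ∈ N₁.1, F x ∈ N₂.1

/-- `F` is an `A`-Fredholm operator, `F ∈ 𝓜Φ(H_A)`. -/
def IsFredholm (F : StdModule A →L[Aᵐᵒᵖ] StdModule A) : Prop :=
  IsAdjointable F ∧ ∃ M₁ M₂ N₁ N₂, IsFredholmDecomposition F M₁ M₂ N₁ N₂

/-- `index F = i`, where `index F = [N₁] - [N₂] ∈ K(A)` for a Fredholm decomposition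
`M₁ ⊕̃ N₁ → M₂ ⊕̃ N₂` of `F`. -/
def HasIndex (F : StdModule A →L[Aᵐᵒᵖ] StdModule A) (i : KGroup A) : Prop :=
  ∃ M₁ M₂ N₁ N₂, IsFredholmDecomposition F M₁ M₂ N₁ N₂ ∧ i = kClass N₁ - kClass N₂

/-- `F ∈ 𝓜Φ₀(H_A)`: `F` is `A`-Fredholm of index `0`. -/
def IsWeyl (F : StdModule A →L[Aᵐᵒᵖ] StdModule A) : Prop :=
  IsFredholm F ∧ HasIndex F 0

/-- `σ^A(F)`: the `α ∈ A` for which `F - αI` is not invertible in the ring `B(H_A)`. -/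
def spec (F : StdModule A →L[Aᵐᵒᵖ] StdModule A) : Set A :=
  {a | ¬ IsUnit (F - scalarOp a)}

/-- `σ^A_ew(F)`: the `α ∈ A` for which `F - αI` is not in `𝓜Φ₀(H_A)`. -/
def weylSpec (F : StdModule A →L[Aᵐᵒᵖ] StdModule A) : Set A :=
  {a | ¬ IsWeyl (F - scalarOp a)}

/-- `σ^A_p(F)`: the `α ∈ A` for which `F - αI` is not injective. -/
def pointSpec (F : StdModule A →L[Aᵐᵒᵖ] StdModule A) : Set A :=
  {a | ¬ Function.Injective (F - scalarOp a)}

/-- `σ^A_cl(F)`: the `α ∈ A` for which the range of `F - αI` is not closed. -/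
def closedRangeSpec (F : StdModule A →L[Aᵐᵒᵖ] StdModule A) : Set A :=
  {a | ¬ IsClosed (Set.range (F - scalarOp a))}

end HilbertCStar

end

open scoped MulOpposite

noncomputable section

namespace HilbertCStar

variable {A : Type*} [CStarAlgebra A]

/-! ### Inner product and norm on `H_A`. -/

namespace StdModule

/-! Put G = F - αI. The substance is that a Weyl operator G that is injective with closed range is
invertible (`isUnit_of_isWeyl`). By the open mapping theorem such a G is bounded below. For t ≥ 0,
positivity of t⟨x,x⟩ and Cauchy-Schwarz give ‖Gx‖² ≤ ‖x‖ ‖(G*G + t)x‖, so G*G + t is bounded below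
uniformly in t. It is invertible for large t, hence down to t = 0, and S = (G*G)⁻¹G* is a left
inverse of G (`exists_left_inverse`). Now ker S complements the range of G. Comparing this splitting
with a Fredholm decomposition gives N₂ ≅ N₁ ⊕ ker S (`exists_equiv_prod_ker`). Index zero forces
[ker S] = 0, cancellation forces ker S = 0, and G is onto. Conversely, an invertible G is bijective,
and it is Weyl through the decomposition with N₁ = N₂ = 0; its adjoint is F* - α*I. -/

lemma op_inn (x y : StdModule A) : MulOpposite.op (inn x y) =
    ∑' k, MulOpposite.op (y k) * star (MulOpposite.op (x k)) := by
  have h := ((summable_inner x y).hasSum.map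
    (MulOpposite.opAddEquiv (α := A)) MulOpposite.continuous_op).tsum_eq
  simp only [inn]
  rw [MulOpposite.opAddEquiv_apply] at h
  rw [← h]
  rfl

/-- `H_A` as a C*-module in the sense of Mathlib. -/
abbrev cstarModule [PartialOrder Aᵐᵒᵖ] [StarOrderedRing Aᵐᵒᵖ] :
    CStarModule Aᵐᵒᵖ (StdModule A) where
  inner x y := MulOpposite.op (inn x y)
  inner_add_right {x y z} := by
    rw [← MulOpposite.op_add]
    congr 1
    simp only [inn, add_apply, mul_add]
    exact (summable_inner x y).tsum_add (summable_inner x z)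
  inner_self_nonneg {x} := by
    rw [op_inn]
    exact tsum_nonneg fun k => mul_star_self_nonneg _
  inner_self {x} := by
    rw [MulOpposite.op_eq_zero_iff, ← norm_eq_zero, ← Real.sqrt_eq_zero (norm_nonneg _),
      ← norm_def, norm_eq_zero]
  inner_op_smul_right {a x y} := by
    apply MulOpposite.unop_injective
    simp only [inn, op_smul_apply, ← mul_assoc, MulOpposite.unop_mul, MulOpposite.unop_op]
    exact (summable_inner x y).tsum_mul_right _
  inner_smul_right_complex {c x y} := by
    apply MulOpposite.unop_injective
    simp only [inn, smul_apply, mul_smul_comm, MulOpposite.unop_smul, MulOpposite.unop_op]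
    exact (summable_inner x y).tsum_const_smul c
  star_inner x y := by
    apply MulOpposite.unop_injective
    simp only [inn, MulOpposite.unop_star, MulOpposite.unop_op]
    rw [tsum_star]
    simp
  norm_eq_sqrt_norm_inner_self _ := rfl

/-- The Cauchy-Schwarz inequality in `H_A`. -/
lemma norm_inn_le (x y : StdModule A) : ‖inn x y‖ ≤ ‖x‖ * ‖y‖ := by
  let _ := CStarAlgebra.spectralOrder Aᵐᵒᵖ
  have := CStarAlgebra.spectralOrderedRing Aᵐᵒᵖ
  let _ := cstarModule (A := A)
  exact CStarModule.norm_inner_le (A := Aᵐᵒᵖ) (StdModule A) (x := x) (y := y)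

lemma norm_sq_eq (x : StdModule A) : ‖x‖ ^ 2 = ‖inn x x‖ := by
  rw [norm_def, Real.sq_sqrt (norm_nonneg _)]

lemma inn_add_right (x y z : StdModule A) : inn x (y + z) = inn x y + inn x z := by
  simp only [inn, add_apply, mul_add]
  exact (summable_inner x y).tsum_add (summable_inner x z)

lemma inn_smul_right (c : ℂ) (x y : StdModule A) : inn x (c • y) = c • inn x y := by
  simp only [inn, smul_apply, mul_smul_comm]
  exact (summable_inner x y).tsum_const_smul c

lemma inn_self_nonneg [PartialOrder A] [StarOrderedRing A] (x : StdModule A) : 0 ≤ inn x x :=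
  tsum_nonneg fun _ => star_mul_self_nonneg _

lemma inn_sub_right (x y z : StdModule A) : inn x (y - z) = inn x y - inn x z := by
  rw [eq_sub_iff_add_eq, ← inn_add_right, sub_add_cancel]

lemma inn_sub_left (x y z : StdModule A) : inn (x - y) z = inn x z - inn y z := by
  rw [inn, inn, inn, ← (summable_inner x z).tsum_sub (summable_inner y z)]
  refine tsum_congr fun k => ?_
  rw [← sub_mul, ← star_sub]
  rfl

lemma scalarOp_inn (a : A) (x y : StdModule A) :
    inn (scalarOp a x) y = inn x (scalarOp (star a) y) :=
  tsum_congr fun k => by simp [mul_assoc]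

/-! ### Completeness of `H_A`. -/

lemma norm_sum_le (x : StdModule A) (s : Finset ℕ) :
    ‖∑ k ∈ s, star (x k) * x k‖ ≤ ‖x‖ ^ 2 := by
  let _ := CStarAlgebra.spectralOrder A
  have := CStarAlgebra.spectralOrderedRing A
  rw [norm_sq_eq]
  exact CStarAlgebra.norm_le_norm_of_nonneg_of_le
    (Finset.sum_nonneg fun k _ => star_mul_self_nonneg _)
    ((summable_sq x).sum_le_tsum s fun k _ => star_mul_self_nonneg _)

lemma norm_apply_le (x : StdModule A) (k : ℕ) : ‖x k‖ ≤ ‖x‖ := by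
  have h := norm_sum_le x {k}
  rw [Finset.sum_singleton, CStarRing.norm_star_mul_self, ← sq] at h
  exact (pow_le_pow_iff_left₀ (norm_nonneg _) (norm_nonneg _) two_ne_zero).1 h

/-- The restriction of a sequence to a finite set of indices. -/
def trunc (s : Finset ℕ) (z : ℕ → A) : StdModule A :=
  ⟨fun k => if k ∈ s then z k else 0,
    summable_of_ne_finset_zero (s := s) fun k hk => by simp [hk]⟩

/-- Makes the norm of a finite block a module norm even when z is not known to be square summable,
so that the triangle inequality applies to blocks. -/
lemma norm_trunc_sq (s : Finset ℕ) (z : ℕ → A) :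
    ‖trunc s z‖ ^ 2 = ‖∑ k ∈ s, star (z k) * z k‖ := by
  rw [norm_sq_eq, inn, tsum_eq_sum (s := s) fun k hk => by simp [trunc, hk]]
  congr 1
  exact Finset.sum_congr rfl fun k hk => by simp [trunc, hk]

lemma trunc_add (s : Finset ℕ) (z w : ℕ → A) : trunc s (z + w) = trunc s z + trunc s w := by
  ext k
  rw [add_apply]
  by_cases hk : k ∈ s <;> simp [trunc, hk]

lemma norm_le_of_forall_sum_le {x : StdModule A} {c : ℝ} (hc : 0 ≤ c)
    (h : ∀ s : Finset ℕ, ‖∑ k ∈ s, star (x k) * x k‖ ≤ c ^ 2) : ‖x‖ ≤ c := by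
  rw [← pow_le_pow_iff_left₀ (norm_nonneg _) hc two_ne_zero, norm_sq_eq]
  exact le_of_tendsto (summable_sq x).hasSum.norm (Filter.Eventually.of_forall h)

instance : CompleteSpace (StdModule A) := by
  refine Metric.complete_of_cauchySeq_tendsto fun u hu => ?_
  have hcoord (k : ℕ) : CauchySeq fun n => u n k := by
    rw [Metric.cauchySeq_iff'] at hu ⊢
    intro ε hε
    obtain ⟨N, hN⟩ := hu ε hε
    refine ⟨N, fun n hn => lt_of_le_of_lt ?_ (hN n hn)⟩
    rw [dist_eq_norm, dist_eq_norm]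
    exact norm_apply_le (u n - u N) k
  choose y hy using fun k => cauchySeq_tendsto_of_complete (hcoord k)
  have hlim : ∀ ε > 0, ∃ N, ∀ n ≥ N, ∀ s : Finset ℕ,
      ‖∑ k ∈ s, star (y k - u n k) * (y k - u n k)‖ ≤ ε ^ 2 := by
    intro ε hε
    obtain ⟨N, hN⟩ := Metric.cauchySeq_iff.1 hu ε hε
    refine ⟨N, fun n hn s => ?_⟩
    have ht : Filter.Tendsto (fun m => ‖∑ k ∈ s, star (u m k - u n k) * (u m k - u n k)‖)
        Filter.atTop (nhds ‖∑ k ∈ s, star (y k - u n k) * (y k - u n k)‖) :=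
      (tendsto_finsetSum s fun k _ =>
        (((hy k).sub_const _).star).mul ((hy k).sub_const _)).norm
    -- Let m → ∞ in the Cauchy estimate on each finite block; N does not depend on the block.
    refine le_of_tendsto ht ((Filter.eventually_ge_atTop N).mono fun m hm => ?_)
    refine (norm_sum_le (u m - u n) s).trans ?_
    have := hN m hm n hn
    rw [dist_eq_norm] at this
    gcongr
  have hsum : Summable fun k => star (y k) * y k := by
    rw [summable_iff_vanishing_norm]
    intro ε hε
    -- A block of y is the sum of the blocks of y - u N and u N, each of norm at most √ε / 3; the
    -- third share makes the bound strict.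
    have hδ : 0 < √ε / 3 := by positivity
    obtain ⟨N, hN⟩ := hlim _ hδ
    obtain ⟨s, hs⟩ := summable_iff_vanishing_norm.1 (summable_sq (u N)) ((√ε / 3) ^ 2)
      (by positivity)
    refine ⟨s, fun t ht => ?_⟩
    have h1 : ‖trunc t (u N)‖ ≤ √ε / 3 := by
      rw [← pow_le_pow_iff_left₀ (norm_nonneg _) hδ.le two_ne_zero, norm_trunc_sq]
      exact (hs t ht).le
    have h2 : ‖trunc t (y - (u N).1)‖ ≤ √ε / 3 := by
      rw [← pow_le_pow_iff_left₀ (norm_nonneg _) hδ.le two_ne_zero, norm_trunc_sq]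
      exact hN N le_rfl t
    have h3 : ‖trunc t y‖ < √ε := by
      have := norm_add_le (trunc t (y - (u N).1)) (trunc t (u N))
      rw [← trunc_add, sub_add_cancel] at this
      have : 0 < √ε := by positivity
      linarith
    rw [← norm_trunc_sq, ← Real.sq_sqrt hε.le]
    gcongr
  obtain ⟨Y, rfl⟩ : ∃ Y : StdModule A, Y.1 = y := ⟨⟨y, hsum⟩, rfl⟩
  refine ⟨Y, Metric.tendsto_atTop.2 fun ε hε => ?_⟩
  obtain ⟨N, hN⟩ := hlim (ε / 2) (half_pos hε)
  refine ⟨N, fun n hn => ?_⟩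
  rw [dist_comm, dist_eq_norm]
  exact (norm_le_of_forall_sum_le (x := Y - u n) (half_pos hε).le
    (hN n hn)).trans_lt (half_lt_self hε)

instance : IsScalarTower ℂ Aᵐᵒᵖ (StdModule A) :=
  inferInstanceAs (IsScalarTower ℂ Aᵐᵒᵖ (squareSummable A))

end StdModule

/-! ### Invertibility and left inverses. -/

open StdModule

/-- The method of continuity along the ray `T + t`, `t ≥ 0`, where a uniform lower bound is
given. -/
lemma isUnit_of_forall_norm_le {E : Type*} [NormedAddCommGroup E] [NormedSpace ℂ E]
    [CompleteSpace E] (T : E →L[ℂ] E) {c : ℝ} (hc : 0 < c)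
    (h : ∀ t : ℝ, 0 ≤ t → ∀ x, c * ‖x‖ ≤ ‖T x + (t : ℂ) • x‖) : IsUnit T := by
  rcases subsingleton_or_nontrivial E with hE | hE
  · exact ⟨1, Subsingleton.elim _ _⟩
  let S (t : ℝ) : E →L[ℂ] E := T + (t : ℂ) • 1
  -- The lower bound gives ‖S(t)⁻¹‖ ≤ c⁻¹, so invertibility spreads over a radius c independent of
  -- t.
  have hstep (s t : ℝ) (ht : 0 ≤ t) (hst : |s - t| < c) (hu : IsUnit (S t)) : IsUnit (S s) := by
    obtain ⟨U, hU⟩ := hu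
    have hinv : ‖(↑U⁻¹ : E →L[ℂ] E)‖ ≤ c⁻¹ := by
      refine ContinuousLinearMap.opNorm_le_bound _ (by positivity) fun x => ?_
      have h1 := h t ht ((↑U⁻¹ : E →L[ℂ] E) x)
      have h2 : S t ((↑U⁻¹ : E →L[ℂ] E) x) = x := by
        rw [← hU, ← mul_apply_eq_comp, Units.mul_inv]; rfl
      change c * _ ≤ ‖S t _‖ at h1
      rw [h2] at h1
      rwa [inv_mul_eq_div, le_div_iff₀' hc]
    refine ⟨U.ofNearby (S s) ?_, rfl⟩
    have hpos : 0 < ‖(↑U⁻¹ : E →L[ℂ] E)‖ := Units.norm_pos _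
    refine lt_of_lt_of_le ?_ ((le_inv_comm₀ hpos hc).1 hinv)
    have : S s - (U : E →L[ℂ] E) = ((s - t : ℝ) : ℂ) • 1 := by
      rw [hU]
      simp only [S, Complex.ofReal_sub, sub_smul]
      abel
    rw [this, norm_smul, norm_one, mul_one, Complex.norm_real, Real.norm_eq_abs]
    exact hst
  -- Start at N · c/2 > ‖T‖, where the Neumann series converges, and descend to 0 in N steps of
  -- length c/2 < c.
  obtain ⟨N, hN⟩ := exists_nat_gt (‖T‖ / (c / 2))
  have hN' : ‖T‖ < N * (c / 2) := by rwa [div_lt_iff₀ (by positivity)] at hN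
  have hlarge : IsUnit (S (N * (c / 2))) := by
    have hpos : 0 < N * (c / 2) := (norm_nonneg T).trans_lt hN'
    have hne : ((N * (c / 2) : ℝ) : ℂ) ≠ 0 := by exact_mod_cast hpos.ne'
    have h1 : IsUnit (((N * (c / 2) : ℝ) : ℂ) • (1 : E →L[ℂ] E)) :=
      (isUnit_one).smul (Units.mk0 _ hne)
    have h2 : IsUnit (1 - (-(((N * (c / 2) : ℝ) : ℂ)⁻¹ • T))) := by
      refine isUnit_one_sub_of_norm_lt_one ?_
      rw [norm_neg, norm_smul, norm_inv, Complex.norm_real, Real.norm_of_nonneg hpos.le,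
        inv_mul_lt_one₀ hpos]
      exact hN'
    convert h1.mul h2 using 1
    simp only [S, sub_neg_eq_add, mul_add, mul_one, smul_mul_smul_comm, one_mul,
      mul_inv_cancel₀ hne, one_smul]
    abel
  have hdesc : ∀ k ≤ N, IsUnit (S ((N - k : ℕ) * (c / 2))) := by
    intro k
    induction k with
    | zero => intro _; simpa using hlarge
    | succ k ih =>
      intro hk
      refine hstep _ _ (by positivity) ?_ (ih (by omega))
      rw [Nat.cast_sub hk, Nat.cast_sub (by omega : k ≤ N), Nat.cast_succ, abs_lt]
      constructor <;> linarith
  simpa [S] using hdesc N le_rfl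

lemma isUnit_of_inverse {G S : StdModule A →L[Aᵐᵒᵖ] StdModule A}
    (h1 : ∀ x, S (G x) = x) (h2 : ∀ x, G (S x) = x) : IsUnit G :=
  ⟨⟨G, S, ContinuousLinearMap.ext h2, ContinuousLinearMap.ext h1⟩, rfl⟩

/-- The algebraic inverse is automatically `A`-linear, and it agrees with the continuous
complex-linear one. -/
lemma isUnit_of_isUnit_restrictScalars (T : StdModule A →L[Aᵐᵒᵖ] StdModule A)
    (hT : IsUnit (T.restrictScalars ℂ)) : IsUnit T := by
  have hb : Function.Bijective T := ContinuousLinearMap.isUnit_iff_bijective.1 hT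
  obtain ⟨U, hU⟩ := hT
  let e := LinearEquiv.ofBijective T.toLinearMap hb
  have he (x) : (↑U⁻¹ : StdModule A →L[ℂ] StdModule A) x = e.symm x := by
    apply hb.1
    change _ = e (e.symm x)
    rw [e.apply_symm_apply]
    change T.restrictScalars ℂ _ = x
    rw [← hU, ← mul_apply_eq_comp, Units.mul_inv]
    rfl
  let S : StdModule A →L[Aᵐᵒᵖ] StdModule A := ⟨e.symm.toLinearMap, by
    have := (↑U⁻¹ : StdModule A →L[ℂ] StdModule A).continuous
    exact this.congr he⟩
  exact isUnit_of_inverse (S := S) (fun x => e.symm_apply_apply x) fun x => e.apply_symm_apply x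

/-- An adjointable operator that is injective with closed range has a bounded left inverse. -/
lemma exists_left_inverse {G : StdModule A →L[Aᵐᵒᵖ] StdModule A} (hG : IsAdjointable G)
    (hinj : Function.Injective G) (hcl : IsClosed (Set.range G)) :
    ∃ S : StdModule A →L[Aᵐᵒᵖ] StdModule A, ∀ x, S (G x) = x := by
  obtain ⟨H, hH⟩ := hG
  obtain ⟨C, hanti⟩ :=
    (G.restrictScalars ℂ).antilipschitz_of_injective_of_isClosed_range hinj hcl
  obtain ⟨K, hK0, hbound⟩ : ∃ K : ℝ, 0 < K ∧ ∀ x, ‖x‖ ≤ K * ‖G x‖ := by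
    -- C itself may be 0.
    refine ⟨C + 1, by positivity, fun x => ?_⟩
    have h : ‖x‖ ≤ C * ‖G x‖ := by simpa using hanti.le_mul_dist x 0
    linarith [norm_nonneg (G x)]
  have hunit : IsUnit (H ∘L G) := by
    refine isUnit_of_isUnit_restrictScalars _ (isUnit_of_forall_norm_le _
      (c := (K ^ 2)⁻¹) (by positivity) fun t ht x => ?_)
    change _ ≤ ‖H (G x) + (t : ℂ) • x‖
    let _ := CStarAlgebra.spectralOrder A
    have := CStarAlgebra.spectralOrderedRing A
    rcases eq_or_ne x 0 with rfl | hx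
    · simp
    have hx0 : 0 < ‖x‖ := norm_pos_iff.2 hx
    have h1 : ‖G x‖ ^ 2 ≤ ‖inn x (H (G x) + (t : ℂ) • x)‖ := by
      rw [inn_add_right, inn_smul_right, ← hH, norm_sq_eq]
      refine CStarAlgebra.norm_le_norm_of_nonneg_of_le (inn_self_nonneg _)
        (le_add_of_nonneg_right ?_)
      rw [Complex.coe_smul]
      exact smul_nonneg ht (inn_self_nonneg x)
    have h2 := h1.trans (norm_inn_le _ _)
    have h3 : ‖x‖ ^ 2 ≤ K ^ 2 * ‖G x‖ ^ 2 := by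
      rw [← mul_pow]
      gcongr
      exact hbound x
    rw [inv_mul_le_iff₀ (by positivity)]
    refine le_of_mul_le_mul_left ?_ hx0
    calc ‖x‖ * ‖x‖ = ‖x‖ ^ 2 := (sq _).symm
      _ ≤ K ^ 2 * ‖G x‖ ^ 2 := h3
      _ ≤ K ^ 2 * (‖x‖ * _) := by gcongr
      _ = _ := by ring
  obtain ⟨U, hU⟩ := hunit
  refine ⟨(↑U⁻¹ : StdModule A →L[Aᵐᵒᵖ] StdModule A) ∘L H, fun x => ?_⟩
  change (↑U⁻¹ : StdModule A →L[Aᵐᵒᵖ] StdModule A) ((H ∘L G) x) = x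
  rw [← hU, ← mul_apply_eq_comp, Units.inv_mul]
  rfl

/-! ### Complemented submodules and classes in `K(A)`. -/

/-- The projection onto a closed submodule along a closed complement is bounded. -/
lemma continuous_projectionOnto {M N : Submodule Aᵐᵒᵖ (StdModule A)} (h : IsCompl M N)
    (hM : IsClosed (M : Set (StdModule A))) (hN : IsClosed (N : Set (StdModule A))) :
    Continuous (M.projectionOnto N h) := by
  have : CompleteSpace M := hM.completeSpace_coe
  refine ((M.projectionOnto N h).restrictScalars ℂ).continuous_of_seq_closed_graph
    fun u x y hu hy => ?_
  change Filter.Tendsto (fun n => M.projectionOnto N h (u n)) Filter.atTop (nhds y) at hy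
  change y = M.projectionOnto N h x
  -- Closed graph: the N-components of u n converge to x - y, and N is closed.
  have hmem : x - y ∈ N := by
    refine hN.mem_of_tendsto (hu.sub ((continuous_subtype_val.tendsto y).comp hy))
      (Filter.Eventually.of_forall fun n => ?_)
    have := Submodule.sub_projection_mem h (u n)
    rwa [Submodule.projection_apply] at this
  have := (Submodule.projectionOnto_apply_eq_zero_iff h).2 hmem
  rw [map_sub, Submodule.projectionOnto_apply_left, sub_eq_zero] at this
  exact this.symm

lemma kClass_eq_add {M N P : FGSubmodule A} (e : M.1 ≃L[Aᵐᵒᵖ] (N.1 × P.1)) :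
    kClass M = kClass N + kClass P := by
  rw [kClass, kClass, kClass, ← QuotientAddGroup.mk_add, eq_comm, QuotientAddGroup.eq,
    neg_add_eq_sub]
  exact AddSubgroup.subset_closure ⟨M, N, P, ⟨e⟩, rfl⟩

/-- The zero submodule. -/
def zeroSubmodule : FGSubmodule A :=
  ⟨⊥, by simp, Submodule.fg_bot⟩

lemma subsingleton_zeroSubmodule : Subsingleton (zeroSubmodule (A := A)).1 :=
  inferInstanceAs (Subsingleton (⊥ : Submodule Aᵐᵒᵖ (StdModule A)))

lemma kClass_zeroSubmodule : kClass (zeroSubmodule (A := A)) = 0 := by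
  have := subsingleton_zeroSubmodule (A := A)
  have h := kClass_eq_add (M := zeroSubmodule (A := A)) (N := zeroSubmodule) (P := zeroSubmodule)
    (ContinuousLinearEquiv.equivOfInverse 0 0 (fun _ => Subsingleton.elim _ _)
      fun _ => Subsingleton.elim _ _)
  exact left_eq_add.1 h

/-- If `G` has a bounded left inverse `S`, then the cokernel `ker S` splits off `N₂`. -/
lemma exists_equiv_prod_ker {G S : StdModule A →L[Aᵐᵒᵖ] StdModule A} (hS : ∀ x, S (G x) = x)
    {M₁ M₂ : Submodule Aᵐᵒᵖ (StdModule A)} {N₁ N₂ : FGSubmodule A}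
    (hd : IsFredholmDecomposition G M₁ M₂ N₁ N₂) :
    ∃ K : FGSubmodule A, K.1 = LinearMap.ker S.toLinearMap ∧
      Nonempty (N₂.1 ≃L[Aᵐᵒᵖ] (N₁.1 × K.1)) := by
  obtain ⟨e, he⟩ := hd.exists_equiv
  let P : StdModule A →ₗ[Aᵐᵒᵖ] StdModule A := LinearMap.id - (G ∘L S).toLinearMap
  have hP (x) : P x = x - G (S x) := rfl
  have hSP (x) : S (P x) = 0 := by rw [hP, map_sub, hS, sub_self]
  have hPG (x) : P (G x) = 0 := by rw [hP, hS, sub_self]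
  have hPK (x) (hx : S x = 0) : P x = x := by rw [hP, hx, map_zero, sub_zero]
  have hM₂ (y) (hy : y ∈ M₂) : ∃ x ∈ M₁, G x = y :=
    ⟨e.symm ⟨y, hy⟩, (e.symm ⟨y, hy⟩).2, by rw [← he, e.apply_symm_apply]⟩
  have hM₁ (x) (hx : x ∈ M₁) : G x ∈ M₂ := by rw [← he ⟨x, hx⟩]; exact (e ⟨x, hx⟩).2
  have hfg : (LinearMap.ker S.toLinearMap).FG := by
    -- P = 1 - GS fixes ker S and kills M₂ = G(M₁), so ker S = P(N₂) is finitely generated.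
    convert N₂.2.2.map P using 1
    ext y
    constructor
    · intro hy
      refine ⟨N₂.1.projection M₂ hd.isCompl_cod.symm y, Submodule.projection_apply_mem _ _, ?_⟩
      obtain ⟨x, -, hx⟩ := hM₂ _ (Submodule.sub_projection_mem hd.isCompl_cod.symm y)
      have h0 := hPG x
      rw [hx, map_sub, sub_eq_zero] at h0
      rw [← h0]
      exact hPK y hy
    · rintro ⟨x, -, rfl⟩
      exact hSP x
  let K : FGSubmodule A := ⟨LinearMap.ker S.toLinearMap, S.isClosed_ker, hfg⟩
  let π₁ : StdModule A →L[Aᵐᵒᵖ] N₁.1 := ⟨N₁.1.projectionOnto M₁ hd.isCompl_dom.symm,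
    continuous_projectionOnto _ N₁.2.1 hd.isClosed_dom⟩
  let π₂ : StdModule A →L[Aᵐᵒᵖ] N₂.1 := ⟨N₂.1.projectionOnto M₂ hd.isCompl_cod.symm,
    continuous_projectionOnto _ N₂.2.1 hd.isClosed_cod⟩
  have hπ₁ (n : N₁.1) : π₁ n = n := Submodule.projectionOnto_apply_left _ n
  have hπ₁' (x) (hx : x ∈ M₁) : π₁ x = 0 :=
    (Submodule.projectionOnto_apply_eq_zero_iff _).2 hx
  have hπ₂ (n : N₂.1) : π₂ n = n := Submodule.projectionOnto_apply_left _ n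
  have hπ₂' (x) (hx : x ∈ M₂) : π₂ x = 0 :=
    (Submodule.projectionOnto_apply_eq_zero_iff _).2 hx
  have hπ₁c (x) : x - π₁ x ∈ M₁ := by
    rw [← Submodule.projectionOnto_apply_eq_zero_iff hd.isCompl_dom.symm]
    change π₁ _ = 0
    rw [map_sub, hπ₁, sub_self]
  have hπ₂c (x) : x - π₂ x ∈ M₂ := by
    rw [← Submodule.projectionOnto_apply_eq_zero_iff hd.isCompl_cod.symm]
    change π₂ _ = 0
    rw [map_sub, hπ₂, sub_self]
  let Pc : StdModule A →L[Aᵐᵒᵖ] K.1 :=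
    (ContinuousLinearMap.id _ _ - G ∘L S).codRestrict K.1 hSP
  let f : N₂.1 →L[Aᵐᵒᵖ] (N₁.1 × K.1) :=
    ((π₁ ∘L S).prod Pc) ∘L N₂.1.subtypeL
  let g : (N₁.1 × K.1) →L[Aᵐᵒᵖ] N₂.1 :=
    π₂ ∘L ((G ∘L N₁.1.subtypeL).coprod K.1.subtypeL)
  refine ⟨K, rfl, ⟨ContinuousLinearEquiv.equivOfInverse f g (fun y => ?_) fun p => ?_⟩⟩
  · change π₂ (G (π₁ (S y)) + (y - G (S y))) = y
    -- The error term is G of an element of M₁, hence lies in M₂ and is killed by π₂.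
    have h1 : G (π₁ (S y)) + ((y : StdModule A) - G (S y)) = y - G (S y - π₁ (S y)) := by
      rw [map_sub]; abel
    rw [h1, map_sub, hπ₂, hπ₂' _ (hM₁ _ (hπ₁c _)), sub_zero]
  · obtain ⟨n, k⟩ := p
    have hk : S k = 0 := k.2
    set z : StdModule A := G n + k with hz
    -- π₂ changes z only by some G m with m ∈ M₁, which both π₁ ∘ S and P annihilate.
    obtain ⟨m, hm, hGm⟩ := hM₂ _ (hπ₂c z)
    have hy : (π₂ z : StdModule A) = z - G m := by rw [hGm]; abel
    have hSy : S (π₂ z) = n - m := by rw [hy, map_sub, hS, hz, map_add, hS, hk, add_zero]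
    change (π₁ (S (π₂ z)), Pc (π₂ z)) = (n, k)
    refine Prod.ext ?_ (Subtype.ext ?_)
    · change π₁ (S (π₂ z)) = n
      rw [hSy, map_sub, hπ₁, hπ₁' _ hm, sub_zero]
    · change P (π₂ z) = k
      rw [hy, map_sub, hPG, hz, map_add, hPG, zero_add, sub_zero, hPK _ hk]

/-! ### Weyl operators and invertibility. -/

lemma isUnit_of_isWeyl (hA : HasCancellation A) {G : StdModule A →L[Aᵐᵒᵖ] StdModule A}
    (hG : IsWeyl G) (hinj : Function.Injective G) (hcl : IsClosed (Set.range G)) :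
    IsUnit G := by
  obtain ⟨S, hS⟩ := exists_left_inverse hG.1.1 hinj hcl
  obtain ⟨M₁, M₂, N₁, N₂, hd, hi⟩ := hG.2
  obtain ⟨K, hK, ⟨e⟩⟩ := exists_equiv_prod_ker hS hd
  have hadd := kClass_eq_add e
  rw [← sub_eq_zero.1 hi.symm, left_eq_add, ← kClass_zeroSubmodule] at hadd
  obtain ⟨φ⟩ := hA _ _ hadd
  have := subsingleton_zeroSubmodule (A := A)
  refine isUnit_of_inverse hS fun x => ?_
  have hx : x - G (S x) ∈ K.1 := by
    rw [hK]
    change S (x - G (S x)) = 0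
    rw [map_sub, hS, sub_self]
  -- Cancellation has made ker S isomorphic to 0, so the defect x - G(Sx), which lies in ker S,
  -- vanishes.
  have h0 : (⟨_, hx⟩ : K.1) = 0 := φ.injective (Subsingleton.elim _ _)
  exact (sub_eq_zero.1 (congrArg Subtype.val h0)).symm

lemma bijective_of_isUnit {G : StdModule A →L[Aᵐᵒᵖ] StdModule A} (hG : IsUnit G) :
    Function.Bijective G := by
  obtain ⟨U, rfl⟩ := hG
  refine Function.bijective_iff_has_inverse.2
    ⟨(↑U⁻¹ : StdModule A →L[Aᵐᵒᵖ] StdModule A), fun x => ?_, fun x => ?_⟩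
  · rw [← mul_apply_eq_comp, Units.inv_mul]; rfl
  · rw [← mul_apply_eq_comp, Units.mul_inv]; rfl

lemma isWeyl_of_isUnit {G : StdModule A →L[Aᵐᵒᵖ] StdModule A} (hadj : IsAdjointable G)
    (hG : IsUnit G) : IsWeyl G := by
  have hd : IsFredholmDecomposition G ⊤ ⊤ zeroSubmodule zeroSubmodule := by
    refine ⟨isClosed_univ, isClosed_univ, isCompl_top_bot, isCompl_top_bot, ?_, ?_⟩
    · obtain ⟨U, rfl⟩ := hG
      let t : (⊤ : Submodule Aᵐᵒᵖ (StdModule A)) ≃L[Aᵐᵒᵖ] StdModule A :=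
        ContinuousLinearEquiv.equivOfInverse (Submodule.subtypeL ⊤)
          ((ContinuousLinearMap.id _ _).codRestrict ⊤ fun _ => trivial)
          (fun _ => rfl) fun _ => rfl
      exact ⟨(t.trans (ContinuousLinearEquiv.unitsEquiv _ _ U)).trans t.symm, fun x => rfl⟩
    · intro x hx
      rw [show x = 0 from hx, map_zero]
      exact Submodule.zero_mem _
  exact ⟨⟨hadj, _, _, _, _, hd⟩, _, _, _, _, hd, (sub_self _).symm⟩

lemma IsAdjointable.sub_scalarOp {F : StdModule A →L[Aᵐᵒᵖ] StdModule A} (hF : IsAdjointable F)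
    (a : A) : IsAdjointable (F - scalarOp a) := by
  obtain ⟨H, hH⟩ := hF
  refine ⟨H - scalarOp (star a), fun x y => ?_⟩
  change inn (F x - scalarOp a x) y = inn x (H y - scalarOp (star a) y)
  rw [inn_sub_left, inn_sub_right, hH, scalarOp_inn]

end HilbertCStar

end

theorem mainTheorem11 {A : Type*} [CStarAlgebra A] (hA : HilbertCStar.HasCancellation A)
    (F : HilbertCStar.StdModule A →L[Aᵐᵒᵖ] HilbertCStar.StdModule A)
    (hF : HilbertCStar.IsAdjointable F) :
    HilbertCStar.spec F =
      HilbertCStar.weylSpec F ∪ HilbertCStar.pointSpec F ∪ HilbertCStar.closedRangeSpec F := by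
  ext a
  refine ⟨fun ha => ?_, fun ha hu => ?_⟩
  · by_contra hn
    simp only [Set.mem_union, not_or] at hn
    obtain ⟨⟨hw, hp⟩, hc⟩ := hn
    exact ha (HilbertCStar.isUnit_of_isWeyl hA (not_not.1 hw) (not_not.1 hp) (not_not.1 hc))
  · have hb := HilbertCStar.bijective_of_isUnit hu
    rcases ha with (hw | hp) | hc
    · exact hw (HilbertCStar.isWeyl_of_isUnit (hF.sub_scalarOp a) hu)
    · exact hp hb.1
    · refine hc ?_
      rw [hb.2.range_eq]
      exact isClosed_univ
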